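/- A probabilistic weighted automaton over a finite alphabet $\Sigma$ consists of a finite set $Q$ of states, an initial probability distribution $\rho_I$ on $Q$, a probabilistic transition function $\delta$ assigning to each $(q,\sigma)\in Q\times\Sigma$ a probability distribution on $Q$, and a weight function $\gamma: Q\times\Sigma\times Q\to\mathbb{Q}$. For an infinite word $w=\sigma_1\sigma_2\dots\in\Sigma^\omega$, a run of $A$ over $w$ is a sequence of states $r=q_0q_1q_2\dots$ with $\rho_I(q_0)>0$ and $\delta(q_i,\sigma_{i+1})(q_{i+1})>0$ for all $i\ge 0$; its weight sequence is $\gamma(r)=v_0v_1\dots$ with $v_i=\gamma(q_i,\sigma_{i+1},q_{i+1})$. Let $\mathbb{P}^A$ be the unique probability measure on the runs over $w$ that gives the set of runs with prefix $q_0q_1\dots q_k$ the probability $\rho_I(q_0)\prod_{i=1}^{k}\delta(q_{i-1},\sigma_i)(q_i)$. For a value function $\mathsf{Val}\in\{\mathsf{LimSup},\mathsf{LimInf}\}$, where $\mathsf{LimSup}(v)=\limsup_{n\to\infty}v_n$ and $\mathsf{LimInf}(v)=\liminf_{n\to\infty}v_n$, the automaton $A$ defines the quantitative language $\Sigma^\omega\to\mathbb{R}$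 $$L^{=1}_A(w)=\sup\{\eta\in\mathbb{R} \mid \mathbb{P}^A(\{r \mid \mathsf{Val}(\gamma(r))\ge\eta\})=1\}$$ under the almost-sure semantics, and $$L^{>0}_A(w)=\sup\{\eta\in\mathbb{R} \mid \mathbb{P}^A(\{r \mid \mathsf{Val}(\gamma(r))\ge\eta\})>0\}$$ under the positive semantics. The classes AsLimSup and AsLimInf (resp. PosLimSup and PosLimInf) consist of the probabilistic weighted automata, over arbitrary finite alphabets, read with $\mathsf{Val}=\mathsf{LimSup}$ and $\mathsf{Val}=\mathsf{LimInf}$ under the almost-sure (resp. positive) semantics. A class $\mathcal{C}$ is reducible to a class $\mathcal{C}'$ if for every automaton $A\in\mathcal{C}$ there is an automaton $A'\in\mathcal{C}'$ over the same alphabet with $L_A(w)=L_{A'}(w)$ for all infinite words $w$. Two classes have incomparable expressive power if neither is reducible to the other. Lemma. AsLimInf and PosLimSup are reducible to each other, whereas AsLimSup and PosLimInf have incomparable expressive power. -/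

import Mathlib

open MeasureTheory ProbabilityTheory Filter
open scoped ENNReal

/-- A probabilistic weighted automaton over the alphabet `α`: a finite set of states, an initial
distribution, a probabilistic transition function and a rational weight function. -/
structure ProbWeightedAutomaton (α : Type) where
  /-- states -/
  Q : Type
  /-- finiteness of the set of states -/
  finite_Q : Finite Q
  /-- initial distribution `ρ_I` -/
  init : PMF Q
  /-- probabilistic transition function `δ` -/
  trans : Q → α → PMF Q
  /-- weight function `γ` -/
  weight : Q → α → Q → ℚ

namespace ProbWeightedAutomaton

variable {α : Type}

instance instFiniteStates (A : ProbWeightedAutomaton α) : Finite A.Q := A.finite_Q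

/-- The finite state space carries the discrete σ-algebra; the sequences of states `ℕ → A.Q` then
carry the product σ-algebra, generated by the cylinders. -/
instance instMeasurableSpaceStates (A : ProbWeightedAutomaton α) : MeasurableSpace A.Q := ⊤

instance instDiscreteStates (A : ProbWeightedAutomaton α) : DiscreteMeasurableSpace A.Q :=
  ⟨fun _ => trivial⟩

/-- `r` is a run over the infinite word `w`. The word `σ₁ σ₂ …` is coded by `w n = σ_{n+1}`, and
the run `q₀ σ₁ q₁ σ₂ …` by its sequence of states `r n = q_n`. -/
def IsRun (A : ProbWeightedAutomaton α) (w : ℕ → α) (r : ℕ → A.Q) : Prop :=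
  0 < A.init (r 0) ∧ ∀ n, 0 < A.trans (r n) (w n) (r (n + 1))

/-- The sequence of weights that occur along a run. -/
def weights (A : ProbWeightedAutomaton α) (w : ℕ → α) (r : ℕ → A.Q) : ℕ → ℚ :=
  fun n => A.weight (r n) (w n) (r (n + 1))

/-- The law of the state at time `n + 1`, given the states up to time `n`. -/
noncomputable def step (A : ProbWeightedAutomaton α) (w : ℕ → α) (n : ℕ) :
    Kernel ((i : Finset.Iic n) → (fun _ : ℕ => A.Q) i) A.Q where
  toFun h := (A.trans (h ⟨n, Finset.mem_Iic.2 le_rfl⟩) (w n)).toMeasure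
  measurable' := by
    have h : Measurable fun q : A.Q => (A.trans q (w n)).toMeasure := measurable_of_finite _
    exact h.comp (measurable_pi_apply _)

instance instMarkovStep (A : ProbWeightedAutomaton α) (w : ℕ → α) (n : ℕ) :
    IsMarkovKernel (A.step w n) :=
  ⟨fun _ => PMF.toMeasure.isProbabilityMeasure _⟩

/-- The probability measure of the automaton on infinite sequences of states, given the word `w`:
start with the initial distribution and follow the transition function. -/
noncomputable def runMeasure (A : ProbWeightedAutomaton α) (w : ℕ → α) : Measure (ℕ → A.Q) :=
  Kernel.trajMeasure (X := fun _ : ℕ => A.Q) A.init.toMeasure (A.step w)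

instance instProbRunMeasure (A : ProbWeightedAutomaton α) (w : ℕ → α) :
    IsProbabilityMeasure (A.runMeasure w) := by
  have : IsProbabilityMeasure A.init.toMeasure := PMF.toMeasure.isProbabilityMeasure _
  unfold runMeasure
  infer_instance

/-- The probability of a cylinder is the probability of the finite run that spans it, so `runMeasure`
is the unique probability measure determined by the probabilities of the finite runs. -/
theorem runMeasure_cylinder (A : ProbWeightedAutomaton α) (w : ℕ → α) (q : ℕ → A.Q) (k : ℕ) :
    A.runMeasure w {r | ∀ i ≤ k, r i = q i} =
      A.init (q 0) * ∏ i ∈ Finset.range k, A.trans (q i) (w i) (q (i + 1)) := by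
  have : IsProbabilityMeasure A.init.toMeasure := PMF.toMeasure.isProbabilityMeasure _
  induction k with
  | zero =>
    have e : {r : ℕ → A.Q | ∀ i ≤ 0, r i = q i} = (fun r => r 0) ⁻¹' {q 0} := by
      ext r; simp
    have key : (A.runMeasure w).map (fun r : ℕ → A.Q => r 0) = A.init.toMeasure := by
      have hf : (fun r : ℕ → A.Q => r 0) =
        (MeasurableEquiv.piUnique (fun i : Finset.Iic 0 => (fun _ : ℕ => A.Q) i)) ∘ (Preorder.frestrictLe (π := fun _ => A.Q) 0) := by
          ext r; rfl
      rw [hf, ← Measure.map_map (by fun_prop) (by fun_prop), runMeasure, Kernel.trajMeasure, Measure.map_comp _ _ (by fun_prop), Kernel.traj_map_frestrictLe, Kernel.partialTraj_self, Measure.id_comp, Measure.map_map (by fun_prop) (by fun_prop)]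
      simp only [MeasurableEquiv.self_comp_symm, Measure.map_id]
    rw [e, ← Measure.map_apply (by fun_prop) (measurableSet_singleton _), key, PMF.toMeasure_apply_singleton _ _ (measurableSet_singleton _)]
    simp
  | succ k ih =>
    have h := Kernel.map_frestrictLe_trajMeasure_compProd_eq_map_trajMeasure (X := fun _ : ℕ => A.Q) (μ₀ := A.init.toMeasure) (κ := A.step w) (a := k)
    have h2 := congrArg (fun m => m ({Preorder.frestrictLe (π := fun _ => A.Q) k q} ×ˢ {q (k+1)})) h
    have ms : MeasurableSet ({Preorder.frestrictLe (π := fun _ => A.Q) k q} : Set _) := measurableSet_singleton _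
    rw [Measure.compProd_apply_prod ms (measurableSet_singleton _), lintegral_singleton, Measure.map_apply (by fun_prop) ms, Measure.map_apply (by fun_prop) (ms.prod (measurableSet_singleton _))] at h2
    have e1 : Preorder.frestrictLe (π := fun _ => A.Q) k ⁻¹' {Preorder.frestrictLe (π := fun _ => A.Q) k q} = {r | ∀ i ≤ k, r i = q i} := by
      ext r; simp [funext_iff]
    have e2 : (fun x : ℕ → A.Q => (Preorder.frestrictLe (π := fun _ => A.Q) k x, x (k + 1))) ⁻¹' ({Preorder.frestrictLe (π := fun _ => A.Q) k q} ×ˢ {q (k+1)}) = {r | ∀ i ≤ k+1, r i = q i} := by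
      ext r; simp [funext_iff, Nat.le_succ_iff, or_imp, forall_and]
    rw [e1, e2] at h2
    have e3 : A.step w k (Preorder.frestrictLe (π := fun _ => A.Q) k q) {q (k+1)} = A.trans (q k) (w k) (q (k+1)) := 
      PMF.toMeasure_apply_singleton _ _ (measurableSet_singleton _)
    rw [e3] at h2
    unfold runMeasure at ih ⊢
    rw [← h2, ih, Finset.prod_range_succ]
    ring

/-- The almost-sure semantics for a value function `Val`. -/
noncomputable def almostSureLang (Val : (ℕ → ℚ) → ℝ) (A : ProbWeightedAutomaton α) (w : ℕ → α) :
    ℝ :=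
  sSup {η : ℝ | A.runMeasure w {r | A.IsRun w r ∧ η ≤ Val (A.weights w r)} = 1}

/-- The positive semantics for a value function `Val`. -/
noncomputable def positiveLang (Val : (ℕ → ℚ) → ℝ) (A : ProbWeightedAutomaton α) (w : ℕ → α) :
    ℝ :=
  sSup {η : ℝ | 0 < A.runMeasure w {r | A.IsRun w r ∧ η ≤ Val (A.weights w r)}}

end ProbWeightedAutomaton

/-- The value function `LimSup`. -/
noncomputable def LimSup (v : ℕ → ℚ) : ℝ := limsup (fun n => (v n : ℝ)) atTop

/-- The value function `LimInf`. -/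
noncomputable def LimInf (v : ℕ → ℚ) : ℝ := liminf (fun n => (v n : ℝ)) atTop

/-- A class of probabilistic weighted automata (all alphabets together), given by the semantics
that assigns to each automaton its quantitative language. -/
abbrev AutomataClass : Type 1 :=
  (α : Type) → ProbWeightedAutomaton α → (ℕ → α) → ℝ

/-- LimSup-automata under the almost-sure semantics. -/
noncomputable def AsLimSup : AutomataClass := fun _ A => A.almostSureLang LimSup

/-- LimInf-automata under the almost-sure semantics. -/
noncomputable def AsLimInf : AutomataClass := fun _ A => A.almostSureLang LimInf

/-- LimSup-automata under the positive semantics. -/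
noncomputable def PosLimSup : AutomataClass := fun _ A => A.positiveLang LimSup

/-- LimInf-automata under the positive semantics. -/
noncomputable def PosLimInf : AutomataClass := fun _ A => A.positiveLang LimInf

/-- `C` is reducible to `C'`: for every automaton of `C`, over any finite alphabet, there is an
automaton of `C'` over the same alphabet with the same quantitative language. -/
def Reducible (C C' : AutomataClass) : Prop :=
  ∀ (α : Type) [Finite α] (A : ProbWeightedAutomaton α),
    ∃ A' : ProbWeightedAutomaton α, ∀ w : ℕ → α, C α A w = C' α A' w

/-- Neither class is reducible to the other. -/
def Incomparable (C C' : AutomataClass) : Prop :=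
  ¬ Reducible C C' ∧ ¬ Reducible C' C

/-!
Changing the signs of the weights exchanges `LimSup` with `LimInf` and the positive with the
almost-sure semantics. Hence both reductions follow from an automaton whose positive
`LimSup`-value is the opposite of that of a given automaton `A`, and both non-reductions follow
from one of them.

Drive `A` by independent random self-maps of its state space. Paths that meet stay together, so
there is a finite largest set of paths that never meet, and every other path merges into one of
them. The positive `LimSup`-value of `A` is at most the weight of an edge `e` if and only if,
almost surely, the weights on these finitely many paths eventually do not exceed the weight of
`e`: by Kolmogorov's zero-one law, a value that some path exceeds infinitely often with positive
probability is almost surely exceeded so by paths that start at infinitely many times. The new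
automaton guesses at a random time such an edge and such a set of paths. It checks the bound on
the weights, and verifies by a breakpoint construction that all other paths merge into the guessed
ones. A right guess has positive probability, and a wrong one is not rewarded.

For a positive `LimInf`-automaton, the probability that all weights from time `N` on exceed a
number `θ` is an infimum of locally constant functions of the word. Therefore the words of value
at most `θ` form a `Gδ` set. An almost-sure `LimSup`-automaton recognizes the words over `Bool` in
which `true` occurs infinitely often, and by the Baire category theorem the other words do not
form a `Gδ` set.
-/

section LimsupFiniteRange

variable {R ι : Type*} [ConditionallyCompleteLinearOrder R] {f : Filter ι} [NeBot f]
  {u : ι → R} {a : R}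

lemma lt_liminf_iff_of_finite_range (hu : (Set.range u).Finite) :
    a < liminf u f ↔ ∀ᶠ i in f, a < u i := by
  refine ⟨fun h => eventually_lt_of_lt_liminf h hu.bddBelow.isBoundedUnder_of_range, fun h => ?_⟩
  have hne : (Set.range u ∩ Set.Ioi a).Nonempty :=
    h.exists.elim fun i hi => ⟨u i, ⟨i, rfl⟩, hi⟩
  obtain ⟨b, ⟨-, hab⟩, hb⟩ := Set.exists_min_image _ id (hu.inter_of_left (Set.Ioi a)) hne
  refine hab.trans_le (le_liminf_of_le hu.bddAbove.isBoundedUnder_of_range.isCoboundedUnder_ge ?_)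
  filter_upwards [h] with i hi using hb _ ⟨⟨i, rfl⟩, hi⟩

lemma le_limsup_iff_of_finite_range (hu : (Set.range u).Finite) :
    a ≤ limsup u f ↔ ∃ᶠ i in f, a ≤ u i := by
  have h : limsup u f < a ↔ ∀ᶠ i in f, u i < a := lt_liminf_iff_of_finite_range (R := Rᵒᵈ) hu
  rw [← not_lt, h, not_eventually]
  simp only [not_lt]

lemma lt_limsup_iff_of_finite_range (hu : (Set.range u).Finite) :
    a < limsup u f ↔ ∃ᶠ i in f, a < u i := by
  refine ⟨frequently_lt_of_lt_limsup hu.bddBelow.isBoundedUnder_of_range.isCoboundedUnder_le,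
    fun h => ?_⟩
  by_contra! hle
  have hlt : ∀ᶠ i in f, ∀ x ∈ Set.range u, a < x → u i < x :=
    (eventually_all_finite hu).2 fun x _ => eventually_imp_distrib_left.2 fun hx =>
      eventually_lt_of_limsup_lt (hle.trans_lt hx) hu.bddAbove.isBoundedUnder_of_range
  obtain ⟨i, hi, hi'⟩ := (h.and_eventually hlt).exists
  exact lt_irrefl _ (hi' _ ⟨i, rfl⟩ hi)

lemma limsup_mem_range_of_finite_range (hu : (Set.range u).Finite) :
    limsup u f ∈ Set.range u := by
  have hge := (le_limsup_iff_of_finite_range (f := f) hu).1 le_rfl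
  have hle : ∀ᶠ i in f, u i ≤ limsup u f := by
    simpa using (lt_limsup_iff_of_finite_range (f := f) hu).not.1 (lt_irrefl _)
  obtain ⟨i, h₁, h₂⟩ := (hge.and_eventually hle).exists
  exact ⟨i, h₂.antisymm h₁⟩

lemma sSup_frequently_le_of_finite_range (hu : (Set.range u).Finite) :
    sSup {η | ∃ᶠ i in f, η ≤ u i} = limsup u f := by
  simp only [← le_limsup_iff_of_finite_range hu]
  exact csSup_Iic

end LimsupFiniteRange

section LimsupNeg

variable {ι : Type*} (u : ι → ℝ) (f : Filter ι)

lemma limsup_neg_real : limsup (fun i => -u i) f = -liminf u f := by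
  rw [limsup_eq, liminf_eq, Real.sInf_def]
  congr 2
  ext x
  simp

lemma liminf_neg_real : liminf (fun i => -u i) f = -limsup u f := by
  simpa using congrArg Neg.neg (limsup_neg_real (fun i => -u i) f).symm

end LimsupNeg

section Flow

variable {β Q : Type*} {f : ℕ → Q → Q} {S : ℕ → Set Q} {T : Set Q} {q : Q} {m n : ℕ}

/-- The sequence without its first `n` terms. -/
def suffix (n : ℕ) (s : ℕ → β) : ℕ → β := fun i => s (n + i)

lemma suffix_zero (s : ℕ → β) : suffix 0 s = s := by
  ext i; simp only [suffix, zero_add]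

lemma suffix_suffix (m n : ℕ) (s : ℕ → β) : suffix n (suffix m s) = suffix (m + n) s := by
  ext i; simp only [suffix, add_assoc]

/-- The composition `f (n - 1) ∘ ⋯ ∘ f 0`. -/
def flow (f : ℕ → Q → Q) : ℕ → Q → Q
  | 0 => id
  | n + 1 => f n ∘ flow f n

lemma flow_add (f : ℕ → Q → Q) (m n : ℕ) (q : Q) :
    flow f (m + n) q = flow (suffix m f) n (flow f m q) := by
  induction n with
  | zero => rfl
  | succ n ih => exact congrArg (f (m + n)) ih

lemma image_flow_add (f : ℕ → Q → Q) (m n : ℕ) (T : Set Q) :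
    flow f (m + n) '' T = flow (suffix m f) n '' (flow f m '' T) := by
  rw [← Set.image_comp]
  exact Set.image_congr fun q _ => flow_add f m n q

lemma mapsTo_flow (hS : ∀ n, Set.MapsTo (f n) (S n) (S (n + 1))) (n : ℕ) :
    Set.MapsTo (flow f n) (S 0) (S n) := by
  induction n with
  | zero => exact Set.mapsTo_id _
  | succ n ih => exact (hS n).comp ih

lemma flow_mem_image_of_le (hmn : m ≤ n) (h : flow f m q ∈ flow f m '' T) :
    flow f n q ∈ flow f n '' T := by
  obtain ⟨k, rfl⟩ := Nat.exists_eq_add_of_le hmn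
  rw [flow_add, image_flow_add]
  exact Set.mem_image_of_mem _ h

open Classical in
/-- The breakpoint construction: the points of `S n` that have not yet merged into the image of `T`
under the flow, where the points of `S n` are only looked at when the previous backlog has been
worked off. -/
noncomputable def backlog (f : ℕ → Q → Q) (S : ℕ → Set Q) (T : Set Q) : ℕ → Set Q
  | 0 => ∅
  | n + 1 =>
    (if backlog f S T n = ∅ then S (n + 1) else f n '' backlog f S T n) \ flow f (n + 1) '' T

lemma flow_mem_image_or_mem_backlog (hS : ∀ n, Set.MapsTo (f n) (S n) (S (n + 1)))
    (hq : q ∈ S 0) (hn : 0 < n) : flow f n q ∈ flow f n '' T ∨ flow f n q ∈ backlog f S T n := by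
  induction n, hn using Nat.le_induction with
  | base =>
    refine or_iff_not_imp_left.2 fun hT => ⟨?_, hT⟩
    rw [if_pos (by rfl)]
    exact mapsTo_flow hS 1 hq
  | succ n _ ih =>
    refine or_iff_not_imp_left.2 fun hT => ⟨?_, hT⟩
    split_ifs
    · exact mapsTo_flow hS (n + 1) hq
    · have hmem := ih.resolve_left fun h => hT (flow_mem_image_of_le n.le_succ h)
      exact Set.mem_image_of_mem (f n) hmem

lemma eventually_flow_mem_image (hS : ∀ n, Set.MapsTo (f n) (S n) (S (n + 1)))
    (hB : ∃ᶠ n in atTop, backlog f S T n = ∅) (hq : q ∈ S 0) :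
    ∀ᶠ n in atTop, flow f n q ∈ flow f n '' T := by
  obtain ⟨m, hm, hBm⟩ := frequently_atTop'.1 hB 0
  have hqm : flow f m q ∈ flow f m '' T := by
    simpa [hBm] using flow_mem_image_or_mem_backlog (T := T) hS hq hm
  filter_upwards [eventually_ge_atTop m] with n hn using flow_mem_image_of_le hn hqm

lemma backlog_subset (hS : ∀ n, Set.MapsTo (f n) (S n) (S (n + 1))) (n : ℕ) :
    backlog f S T n ⊆ S n := by
  induction n with
  | zero => exact Set.empty_subset _
  | succ n ih =>
    refine Set.sdiff_subset.trans ?_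
    split_ifs
    · exact subset_rfl
    · exact ((hS n).mono_left ih).image_subset

/-- No two points of `T` ever merge under the flow. -/
def Noncoalescing (f : ℕ → Q → Q) (T : Set Q) : Prop := ∀ n, Set.InjOn (flow f n) T

/-- `T` is a noncoalescing set of points of `S 0`, and no later `S n` contains a larger one. -/
structure IsMaximalNoncoalescing (f : ℕ → Q → Q) (S : ℕ → Set Q) (T : Set Q) : Prop where
  subset : T ⊆ S 0
  noncoalescing : Noncoalescing f T
  ncard_le : ∀ n, ∀ T' ⊆ S n, Noncoalescing (suffix n f) T' → T'.ncard ≤ T.ncard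

lemma exists_isMaximalNoncoalescing_suffix [Finite Q] (f : ℕ → Q → Q) (S : ℕ → Set Q) :
    ∃ n T, IsMaximalNoncoalescing (suffix n f) (suffix n S) T := by
  let C : Set ℕ := {k | ∃ n, ∃ T ⊆ S n, Noncoalescing (suffix n f) T ∧ T.ncard = k}
  have hne : C.Nonempty := ⟨_, 0, ∅, Set.empty_subset _, fun _ => Set.injOn_empty _, rfl⟩
  have hbdd : BddAbove C := ⟨Nat.card Q, by
    rintro _ ⟨_, T, -, -, rfl⟩
    exact Set.ncard_le_card T⟩
  obtain ⟨n, T, hTS, hT, hcard⟩ := Nat.sSup_mem hne hbdd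
  refine ⟨n, T, hTS, hT, fun m T' hT'S hT' => ?_⟩
  rw [suffix_suffix] at hT'
  exact hcard ▸ le_csSup hbdd ⟨n + m, T', hT'S, hT', rfl⟩

namespace IsMaximalNoncoalescing

variable (hS : ∀ n, Set.MapsTo (f n) (S n) (S (n + 1))) (hT : IsMaximalNoncoalescing f S T)
include hT

include hS in
lemma image_flow (m : ℕ) :
    IsMaximalNoncoalescing (suffix m f) (suffix m S) (flow f m '' T) where
  subset := ((mapsTo_flow hS m).mono_left hT.subset).image_subset
  noncoalescing n := by
    rintro _ ⟨p, hp, rfl⟩ _ ⟨q, hq, rfl⟩ h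
    rw [← flow_add, ← flow_add] at h
    rw [hT.noncoalescing _ hp hq h]
  ncard_le n T' hT'S hT' := by
    rw [(hT.noncoalescing m).ncard_image]
    rw [suffix_suffix] at hT'
    exact hT.ncard_le (m + n) T' hT'S hT'

lemma exists_flow_mem_image [Finite Q] (hq : q ∈ S 0) : ∃ n, flow f n q ∈ flow f n '' T := by
  by_contra! hnot
  have hqT : q ∉ T := by simpa [flow] using hnot 0
  have hinsert : Noncoalescing f (insert q T) := fun n =>
    (Set.injOn_insert hqT).2 ⟨hT.noncoalescing n, hnot n⟩
  have hle := hT.ncard_le 0 _ (Set.insert_subset hq hT.subset)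
    (by rwa [suffix_zero])
  rw [Set.ncard_insert_of_notMem hqT] at hle
  lia

lemma eventually_image_flow_subset [Finite Q] :
    ∀ᶠ n in atTop, flow f n '' S 0 ⊆ flow f n '' T := by
  have hmem : ∀ᶠ n in atTop, ∀ q ∈ S 0, flow f n q ∈ flow f n '' T :=
    (eventually_all_finite (S 0).toFinite).2 fun q hq => by
      obtain ⟨m, hm⟩ := hT.exists_flow_mem_image hq
      filter_upwards [eventually_ge_atTop m] with n hn using flow_mem_image_of_le hn hm
  filter_upwards [hmem] with n hn using Set.image_subset_iff.2 hn

include hS in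
lemma frequently_backlog_eq_empty [Finite Q] : ∃ᶠ n in atTop, backlog f S T n = ∅ := by
  intro hne
  obtain ⟨m, hm⟩ := eventually_atTop.1 hne
  have hsub : ∀ n, backlog f S T (m + n) ⊆ flow (suffix m f) n '' backlog f S T m := by
    intro n
    induction n with
    | zero => simp [flow]
    | succ n ih =>
      rw [← add_assoc, backlog, if_neg (hm (m + n) (by lia))]
      refine Set.sdiff_subset.trans ((Set.image_mono ih).trans ?_)
      rw [← Set.image_comp]
      rfl
  obtain ⟨n, hn, hn0⟩ :=
    ((hT.image_flow hS m).eventually_image_flow_subset.and (eventually_ne_atTop 0)).exists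
  obtain ⟨k, rfl⟩ := Nat.exists_eq_succ_of_ne_zero hn0
  have hmerged : backlog f S T (m + (k + 1)) ⊆ flow f (m + (k + 1)) '' T := by
    rw [image_flow_add]
    exact (hsub _).trans ((Set.image_mono (backlog_subset hS m)).trans hn)
  refine hm (m + (k + 1)) (by lia) (Set.eq_empty_of_forall_notMem fun q hq => ?_)
  exact hq.2 (hmerged hq)

end IsMaximalNoncoalescing

end Flow

section IID

variable {X : Type*} [MeasurableSpace X] (μ : Measure X) [IsProbabilityMeasure μ]
  {p : (ℕ → X) → Prop}

/-- The law of a sequence of independent random variables with law `μ`. -/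
noncomputable abbrev iid : Measure (ℕ → X) := Measure.infinitePi fun _ : ℕ => μ

lemma measurable_suffix (n : ℕ) : Measurable (suffix n : (ℕ → X) → ℕ → X) := by
  unfold suffix; fun_prop

lemma measurePreserving_suffix_iid (n : ℕ) : MeasurePreserving (suffix n) (iid μ) (iid μ) :=
  ⟨measurable_suffix n,
    Measure.map_infinitePi_infinitePi_of_inj (P := fun _ : ℕ => μ) (add_right_injective n)⟩

/-- The σ-algebra generated by the `i`-th coordinate. -/
abbrev coordAlgebra (X : Type*) [MeasurableSpace X] (i : ℕ) : MeasurableSpace (ℕ → X) :=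
  MeasurableSpace.comap (fun ω => ω i) inferInstance

lemma coordAlgebra_le (i : ℕ) : coordAlgebra X i ≤ MeasurableSpace.pi :=
  (measurable_pi_apply i).comap_le

lemma iIndep_coordAlgebra_iid : iIndep (coordAlgebra X) (iid μ) :=
  iIndepFun_infinitePi (X := fun _ x => x) fun _ => measurable_id

lemma measurableSet_iSup_coordAlgebra_preimage_suffix (n : ℕ) {H : Set (ℕ → X)}
    (hH : MeasurableSet H) :
    MeasurableSet[⨆ i ∈ Set.Ici n, coordAlgebra X i] (suffix n ⁻¹' H) := by
  have hmeas : Measurable[⨆ i ∈ Set.Ici n, coordAlgebra X i] (suffix n : (ℕ → X) → ℕ → X) := by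
    refine @measurable_pi_lambda _ _ _ (_) _ _ fun i => ?_
    refine (comap_measurable fun ω : ℕ → X => ω (n + i)).mono ?_ le_rfl
    exact le_biSup (coordAlgebra X) (Set.mem_Ici.2 (n.le_add_right i))
  exact hmeas hH

lemma iid_pi_inter_preimage_suffix (n : ℕ) {t : ℕ → Set X} (ht : ∀ i, MeasurableSet (t i))
    {H : Set (ℕ → X)} (hH : MeasurableSet H) :
    iid μ (Set.pi (Finset.range n) t ∩ suffix n ⁻¹' H) =
      (∏ i ∈ Finset.range n, μ (t i)) * iid μ H := by
  have hindep : Indep (⨆ i ∈ Set.Iio n, coordAlgebra X i) (⨆ i ∈ Set.Ici n, coordAlgebra X i)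
      (iid μ) :=
    indep_iSup_of_disjoint coordAlgebra_le (iIndep_coordAlgebra_iid μ) (Set.Iio_disjoint_Ici le_rfl)
  have hprefix : MeasurableSet[⨆ i ∈ Set.Iio n, coordAlgebra X i] (Set.pi (Finset.range n) t) := by
    rw [Set.pi_def]
    exact .biInter (Finset.countable_toSet _) fun i hi =>
      le_biSup (coordAlgebra X) (Set.mem_Iio.2 (Finset.mem_range.1 hi)) _ ⟨t i, ht i, rfl⟩
  rw [(Indep_iff ..).1 hindep _ _ hprefix (measurableSet_iSup_coordAlgebra_preimage_suffix n hH),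
    (measurePreserving_suffix_iid μ n).measure_preimage hH.nullMeasurableSet,
    Measure.infinitePi_pi _ fun i _ => ht i]

variable {μ}

lemma frequently_prefix_and_suffix {n : ℕ} {t : ℕ → Set X} (ht : ∀ i, MeasurableSet (t i))
    (hpos : ∀ i < n, μ (t i) ≠ 0) (hp : Measurable p) (h : ∃ᶠ ω in ae (iid μ), p ω) :
    ∃ᶠ ω in ae (iid μ), (∀ i < n, ω i ∈ t i) ∧ p (suffix n ω) := by
  have hset : {ω : ℕ → X | (∀ i < n, ω i ∈ t i) ∧ p (suffix n ω)} =
      Set.pi (Finset.range n) t ∩ suffix n ⁻¹' {ω | p ω} := by ext; simp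
  rw [frequently_ae_iff] at h ⊢
  rw [hset, iid_pi_inter_preimage_suffix μ n ht hp.setOf]
  exact mul_ne_zero (Finset.prod_ne_zero_iff.2 fun i hi => hpos i (Finset.mem_range.1 hi)) h

lemma ae_or_ae_not_of_tail (hp : ∀ n, ∃ H, MeasurableSet H ∧ ∀ ω, p ω ↔ suffix n ω ∈ H) :
    (∀ᵐ ω ∂iid μ, p ω) ∨ ∀ᵐ ω ∂iid μ, ¬ p ω := by
  have htail : MeasurableSet[limsup (coordAlgebra X) atTop] {ω | p ω} := by
    rw [limsup_eq_iInf_iSup_of_nat, MeasurableSpace.measurableSet_iInf]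
    intro n
    obtain ⟨H, hH, hpH⟩ := hp n
    exact (Set.ext hpH : {ω | p ω} = suffix n ⁻¹' H) ▸
      measurableSet_iSup_coordAlgebra_preimage_suffix n hH
  have hmeas : MeasurableSet {ω | p ω} := by
    obtain ⟨H, hH, hpH⟩ := hp 0
    exact (Set.ext hpH : {ω | p ω} = suffix 0 ⁻¹' H) ▸ measurable_suffix 0 hH
  rcases measure_zero_or_one_of_measurableSet_limsup_atTop coordAlgebra_le
    (iIndep_coordAlgebra_iid μ) htail with h | h
  · exact Or.inr (measure_eq_zero_iff_ae_notMem.1 h)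
  · exact Or.inl ((mem_ae_iff_prob_eq_one hmeas).2 h)

end IID

section Drive

variable {Q α X : Type*} {g : Q → α → X → Q}

/-- The maps of the state space that the update function `g` performs along the word `w` and the
noise `ω`. -/
def noiseMaps (g : Q → α → X → Q) (w : ℕ → α) (ω : ℕ → X) : ℕ → Q → Q :=
  fun n q => g q (w n) (ω n)

/-- The sequence of states that starts at `q` and follows the update function `g` along the word `w`
and the noise `ω`. -/
def drive (g : Q → α → X → Q) (w : ℕ → α) (q : Q) (ω : ℕ → X) : ℕ → Q :=
  fun n => flow (noiseMaps g w ω) n q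

lemma drive_add (w : ℕ → α) (q : Q) (ω : ℕ → X) (m n : ℕ) :
    drive g w q ω (m + n) = drive g (suffix m w) (drive g w q ω m) (suffix m ω) n :=
  flow_add (noiseMaps g w ω) m n q

lemma drive_preimage_cylinder (w : ℕ → α) (q : ℕ → Q) (k : ℕ) :
    (fun p : Q × (ℕ → X) => drive g w p.1 p.2) ⁻¹' {r | ∀ i ≤ k, r i = q i} =
      {q 0} ×ˢ Set.pi (Finset.range k) fun i => g (q i) (w i) ⁻¹' {q (i + 1)} := by
  ext ⟨q₀, ω⟩
  simp only [Set.mem_preimage, Set.mem_ofPred_eq, Set.mem_prod, Set.mem_singleton_iff, Set.mem_pi,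
    Finset.coe_range, Set.mem_Iio]
  constructor
  · intro h
    refine ⟨h 0 k.zero_le, fun i hi => ?_⟩
    rw [← h i hi.le, ← h (i + 1) hi]
    rfl
  · rintro ⟨h0, h⟩ i hi
    induction i with
    | zero => exact h0
    | succ i ih =>
      rw [← h i hi, ← ih (i.le_succ.trans hi)]
      rfl

variable [Countable Q] [MeasurableSpace Q] [MeasurableSingletonClass Q] [MeasurableSpace X]

lemma measurable_drive (hg : ∀ q a, Measurable (g q a)) (w : ℕ → α) :
    Measurable fun p : Q × (ℕ → X) => drive g w p.1 p.2 := by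
  refine measurable_pi_lambda _ fun n => ?_
  induction n with
  | zero => exact measurable_fst
  | succ n ih =>
    have hstep : Measurable fun p : Q × X => g p.1 (w n) p.2 :=
      measurable_from_prod_countable_right fun q => hg q (w n)
    exact hstep.comp (ih.prodMk ((measurable_pi_apply n).comp measurable_snd))

lemma measurable_drive_right (hg : ∀ q a, Measurable (g q a)) (w : ℕ → α) (q : Q) :
    Measurable fun ω : ℕ → X => drive g w q ω :=
  (measurable_drive hg w).comp measurable_prodMk_left

end Drive

section Cylinder

variable {Q : Type*}

lemma frestrictLe_preimage_singleton (q : ℕ → Q) (k : ℕ) :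
    Preorder.frestrictLe (π := fun _ => Q) k ⁻¹' {Preorder.frestrictLe k q} =
      {r | ∀ i ≤ k, r i = q i} := by
  ext r; simp [funext_iff]

variable [MeasurableSpace Q] [MeasurableSingletonClass Q]

lemma measurableSet_cylinder (q : ℕ → Q) (k : ℕ) :
    MeasurableSet {r : ℕ → Q | ∀ i ≤ k, r i = q i} :=
  frestrictLe_preimage_singleton q k ▸
    Preorder.measurable_frestrictLe k (measurableSet_singleton _)

variable [Countable Q]

lemma measure_ext_of_cylinder {μ ν : Measure (ℕ → Q)} [IsFiniteMeasure μ] [IsFiniteMeasure ν]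
    (h : ∀ (q : ℕ → Q) k, μ {r | ∀ i ≤ k, r i = q i} = ν {r | ∀ i ≤ k, r i = q i}) : μ = ν := by
  have hν := isProjectiveMeasureFamily_map_restrict (P := ν) (X := fun n r => r n)
    fun n => (measurable_pi_apply n).aemeasurable
  have hμ : IsProjectiveLimit μ fun I => ν.map I.restrict := by
    refine (isProjectiveLimit_nat_iff hν μ).2 fun n => Measure.ext_of_singleton fun x => ?_
    obtain ⟨q, rfl⟩ : ∃ q, Preorder.frestrictLe n q = x :=
      ⟨fun i => x ⟨min i n, Finset.mem_Iic.2 (min_le_right i n)⟩, by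
        ext i
        simp [Finset.mem_Iic.1 i.2]⟩
    rw [Measure.map_apply (by fun_prop) (measurableSet_singleton _),
      frestrictLe_preimage_singleton, h, ← frestrictLe_preimage_singleton]
    exact (Measure.map_apply (Preorder.measurable_frestrictLe n) (measurableSet_singleton _)).symm
  exact hμ.unique fun I => rfl

end Cylinder

lemma ae_toMeasure_pos {Q : Type*} [MeasurableSpace Q] [DiscreteMeasurableSpace Q] (p : PMF Q) :
    ∀ᵐ q ∂p.toMeasure, 0 < p q := by
  rw [ae_iff, p.toMeasure_apply_eq_zero_iff .of_discrete, Set.disjoint_left]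
  intro q hq hq'
  exact hq' (pos_iff_ne_zero.2 hq)

namespace ProbWeightedAutomaton

variable {α : Type} {X : Type*} [MeasurableSpace X]

/-- The update function `g`, fed with noise of law `μ`, realizes the transition function of `A`. -/
structure IsRandomMapping (A : ProbWeightedAutomaton α) (μ : Measure X) (g : A.Q → α → X → A.Q) :
    Prop where
  measurable : ∀ q a, Measurable (g q a)
  map_eq : ∀ q a, μ.map (g q a) = (A.trans q a).toMeasure

namespace IsRandomMapping

variable {A : ProbWeightedAutomaton α} {μ : Measure X} {g : A.Q → α → X → A.Q}
  (hg : A.IsRandomMapping μ g) (w : ℕ → α)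
include hg

lemma measure_preimage_singleton (q : A.Q) (a : α) (q' : A.Q) :
    μ (g q a ⁻¹' {q'}) = A.trans q a q' := by
  rw [← Measure.map_apply (hg.measurable q a) .of_discrete, hg.map_eq,
    PMF.toMeasure_apply_singleton _ _ .of_discrete]

variable [IsProbabilityMeasure μ]

lemma ae_trans_pos : ∀ᵐ ω ∂iid μ, ∀ n q, 0 < A.trans q (w n) (g q (w n) (ω n)) := by
  refine ae_all_iff.2 fun n => ae_all_iff.2 fun q => ?_
  have hpos : ∀ᵐ x ∂μ, 0 < A.trans q (w n) (g q (w n) x) :=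
    ae_of_ae_map (hg.measurable q (w n)).aemeasurable
      (hg.map_eq q (w n) ▸ ae_toMeasure_pos (A.trans q (w n)))
  exact (measurePreserving_eval_infinitePi (fun _ : ℕ => μ) n).quasiMeasurePreserving.ae hpos

theorem runMeasure_eq_map :
    A.runMeasure w = (A.init.toMeasure.prod (iid μ)).map fun p => drive g w p.1 p.2 := by
  have := PMF.toMeasure.isProbabilityMeasure A.init
  refine measure_ext_of_cylinder fun q k => ?_
  rw [runMeasure_cylinder, Measure.map_apply (measurable_drive hg.measurable w)
    (measurableSet_cylinder q k), drive_preimage_cylinder, Measure.prod_prod,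
    PMF.toMeasure_apply_singleton _ _ .of_discrete,
    Measure.infinitePi_pi _ fun _ _ => hg.measurable _ _ .of_discrete]
  simp only [hg.measure_preimage_singleton]

lemma ae_runMeasure_iff {p : (ℕ → A.Q) → Prop} (hp : Measurable p) :
    (∀ᵐ r ∂A.runMeasure w, p r) ↔ ∀ q, 0 < A.init q → ∀ᵐ ω ∂iid μ, p (drive g w q ω) := by
  have := PMF.toMeasure.isProbabilityMeasure A.init
  have hdrive := measurable_drive hg.measurable w
  rw [hg.runMeasure_eq_map w, ae_map_iff hdrive.aemeasurable hp.setOf,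
    Measure.ae_prod_iff_ae_ae (p := fun x => p (drive g w x.1 x.2)) (hp.comp hdrive).setOf,
    ae_iff, PMF.toMeasure_apply_eq_zero_iff _ .of_discrete, Set.disjoint_left]
  refine forall_congr' fun q => ?_
  rw [PMF.mem_support_iff, pos_iff_ne_zero]
  exact imp_congr_right fun _ => not_not

end IsRandomMapping

variable (A : ProbWeightedAutomaton α) (w : ℕ → α)

/-- The law of independent moves of all pairs of a letter and a state. -/
noncomputable def moveLaw : Measure (α × A.Q → A.Q) :=
  Measure.infinitePi fun p : α × A.Q => (A.trans p.2 p.1).toMeasure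

instance instProbMoveLaw : IsProbabilityMeasure A.moveLaw := by
  have (p : α × A.Q) := PMF.toMeasure.isProbabilityMeasure (A.trans p.2 p.1)
  unfold moveLaw; infer_instance

lemma isRandomMapping_moveLaw : A.IsRandomMapping A.moveLaw fun q a u => u (a, q) where
  measurable q a := measurable_pi_apply (a, q)
  map_eq q a := by
    have (p : α × A.Q) := PMF.toMeasure.isProbabilityMeasure (A.trans p.2 p.1)
    exact Measure.infinitePi_map_eval (fun p : α × A.Q => (A.trans p.2 p.1).toMeasure) (a, q)

lemma measurable_isRun : Measurable (A.IsRun w) := by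
  have hinit : Measurable fun q => 0 < A.init q := .of_discrete
  have htrans (n : ℕ) : Measurable fun p : A.Q × A.Q => 0 < A.trans p.1 (w n) p.2 := .of_discrete
  have hpair (n : ℕ) : Measurable fun r : ℕ → A.Q => (r n, r (n + 1)) := by fun_prop
  exact (hinit.comp (measurable_pi_apply 0)).and (.forall fun n => (htrans n).comp (hpair n))

lemma ae_isRun : ∀ᵐ r ∂A.runMeasure w, A.IsRun w r := by
  refine (A.isRandomMapping_moveLaw.ae_runMeasure_iff w (A.measurable_isRun w)).2 fun q hq => ?_
  filter_upwards [A.isRandomMapping_moveLaw.ae_trans_pos w] with ω hω using ⟨hq, fun n => hω n _⟩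

/-- A source, a letter and a target: the arguments of the weight function. -/
abbrev Edge : Type := A.Q × α × A.Q

/-- The weight function, uncurried. -/
def edgeWeight (e : A.Edge) : ℚ := A.weight e.1 e.2.1 e.2.2

/-- The automaton with the opposite weights. -/
def neg : ProbWeightedAutomaton α := { A with weight := fun q a q' => -A.weight q a q' }

lemma neg_neg : A.neg.neg = A := by
  simp only [neg, _root_.neg_neg]

variable {w} in
lemma limInf_weights (r : ℕ → A.Q) : LimInf (A.weights w r) = -LimSup (A.neg.weights w r) := by
  rw [LimSup, ← liminf_neg_real]
  simp only [LimInf, weights, neg, Rat.cast_neg, _root_.neg_neg]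

variable {w} in
lemma limSup_weights (r : ℕ → A.Q) : LimSup (A.weights w r) = -LimInf (A.neg.weights w r) := by
  rw [LimInf, ← limsup_neg_real]
  simp only [LimSup, weights, neg, Rat.cast_neg, _root_.neg_neg]

lemma measure_isRun_and_pos_iff {p : (ℕ → A.Q) → Prop} :
    0 < A.runMeasure w {r | A.IsRun w r ∧ p r} ↔ ∃ᶠ r in ae (A.runMeasure w), p r := by
  rw [pos_iff_ne_zero, ← frequently_ae_iff]
  exact frequently_congr ((A.ae_isRun w).mono fun r hr => and_iff_right hr)

lemma measure_isRun_and_eq_one_iff {p : (ℕ → A.Q) → Prop} (hp : Measurable p) :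
    A.runMeasure w {r | A.IsRun w r ∧ p r} = 1 ↔ ∀ᵐ r ∂A.runMeasure w, p r := by
  rw [← mem_ae_iff_prob_eq_one ((A.measurable_isRun w).and hp).setOf]
  exact eventually_congr ((A.ae_isRun w).mono fun r hr => and_iff_right hr)

lemma measurable_weights (n : ℕ) : Measurable fun r => A.weights w r n := by
  have hpair : Measurable fun r : ℕ → A.Q => (r n, r (n + 1)) := by fun_prop
  have hweight : Measurable fun p : A.Q × A.Q => A.weight p.1 (w n) p.2 := .of_discrete
  exact hweight.comp hpair

lemma measurable_cast_weights (n : ℕ) : Measurable fun r => (A.weights w r n : ℝ) :=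
  Measurable.of_discrete.comp (A.measurable_weights w n)

lemma measurable_limSup_weights : Measurable fun r => LimSup (A.weights w r) :=
  .limsup (A.measurable_cast_weights w)

lemma measurable_limInf_weights : Measurable fun r => LimInf (A.weights w r) :=
  .liminf (A.measurable_cast_weights w)

variable {w} in
lemma positiveLang_eq_limsup {Val : (ℕ → ℚ) → ℝ}
    (hVal : (Set.range fun r => Val (A.weights w r)).Finite) :
    A.positiveLang Val w = limsup (fun r => Val (A.weights w r)) (ae (A.runMeasure w)) := by
  simp only [positiveLang, measure_isRun_and_pos_iff, sSup_frequently_le_of_finite_range hVal]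

variable {w} in
lemma almostSureLang_eq_liminf {Val : (ℕ → ℚ) → ℝ}
    (hVal : Measurable fun r => Val (A.weights w r)) :
    A.almostSureLang Val w = liminf (fun r => Val (A.weights w r)) (ae (A.runMeasure w)) := by
  have hmeas (η : ℝ) : Measurable fun r => η ≤ Val (A.weights w r) :=
    measurableSet_setOfPred.1 (measurableSet_le measurable_const hVal)
  simp only [almostSureLang, A.measure_isRun_and_eq_one_iff w (hmeas _), liminf_eq]

variable [Finite α]

lemma finite_range_weights (r : ℕ → A.Q) : (Set.range fun n => (A.weights w r n : ℝ)).Finite :=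
  (Set.finite_range fun e : A.Edge => (A.edgeWeight e : ℝ)).subset <| by
    rintro _ ⟨n, rfl⟩
    exact ⟨(r n, w n, r (n + 1)), rfl⟩

lemma exists_edgeWeight_eq_limSup_weights (r : ℕ → A.Q) :
    ∃ e : A.Edge, (A.edgeWeight e : ℝ) = LimSup (A.weights w r) := by
  obtain ⟨n, hn⟩ := limsup_mem_range_of_finite_range (f := atTop) (A.finite_range_weights w r)
  exact ⟨(r n, w n, r (n + 1)), hn⟩

lemma finite_range_limSup_weights : (Set.range fun r => LimSup (A.weights w r)).Finite :=
  (Set.finite_range fun e : A.Edge => (A.edgeWeight e : ℝ)).subset <| by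
    rintro _ ⟨r, rfl⟩
    exact A.exists_edgeWeight_eq_limSup_weights w r

lemma finite_range_limInf_weights : (Set.range fun r => LimInf (A.weights w r)).Finite := by
  have h := (A.neg.finite_range_limSup_weights w).neg
  rw [Set.neg_range] at h
  simp only [A.limInf_weights]
  exact h

lemma almostSureLang_limInf_eq_neg : A.almostSureLang LimInf w = -A.neg.positiveLang LimSup w := by
  rw [almostSureLang_eq_liminf _ (A.measurable_limInf_weights w),
    positiveLang_eq_limsup _ (A.neg.finite_range_limSup_weights w)]
  simp only [A.limInf_weights, liminf_neg_real]
  rfl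

lemma almostSureLang_limSup_eq_neg : A.almostSureLang LimSup w = -A.neg.positiveLang LimInf w := by
  rw [almostSureLang_eq_liminf _ (A.measurable_limSup_weights w),
    positiveLang_eq_limsup _ (A.neg.finite_range_limInf_weights w)]
  simp only [A.limSup_weights, liminf_neg_real]
  rfl

variable {w} {η : ℝ}

lemma le_positiveLang_limSup_iff :
    η ≤ A.positiveLang LimSup w ↔
      ∃ᶠ r in ae (A.runMeasure w), ∃ᶠ n in atTop, η ≤ A.weights w r n := by
  rw [positiveLang_eq_limsup _ (A.finite_range_limSup_weights w),
    le_limsup_iff_of_finite_range (A.finite_range_limSup_weights w)]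
  simp only [LimSup, le_limsup_iff_of_finite_range (A.finite_range_weights w _)]

lemma lt_positiveLang_limSup_iff :
    η < A.positiveLang LimSup w ↔
      ∃ᶠ r in ae (A.runMeasure w), ∃ᶠ n in atTop, η < A.weights w r n := by
  rw [positiveLang_eq_limsup _ (A.finite_range_limSup_weights w),
    lt_limsup_iff_of_finite_range (A.finite_range_limSup_weights w)]
  simp only [LimSup, lt_limsup_iff_of_finite_range (A.finite_range_weights w _)]

lemma lt_positiveLang_limInf_iff :
    η < A.positiveLang LimInf w ↔
      ∃ᶠ r in ae (A.runMeasure w), ∀ᶠ n in atTop, η < A.weights w r n := by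
  rw [positiveLang_eq_limsup _ (A.finite_range_limInf_weights w),
    lt_limsup_iff_of_finite_range (A.finite_range_limInf_weights w)]
  simp only [LimInf, lt_liminf_iff_of_finite_range (A.finite_range_weights w _)]

variable (w) in
lemma exists_edgeWeight_eq_positiveLang_limSup :
    ∃ e : A.Edge, (A.edgeWeight e : ℝ) = A.positiveLang LimSup w := by
  obtain ⟨r, hr⟩ := limsup_mem_range_of_finite_range (f := ae (A.runMeasure w))
    (A.finite_range_limSup_weights w)
  rw [positiveLang_eq_limsup _ (A.finite_range_limSup_weights w), ← hr]
  exact A.exists_edgeWeight_eq_limSup_weights w r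

end ProbWeightedAutomaton

lemma frequently_add_atTop_iff {p : ℕ → Prop} (n : ℕ) :
    (∃ᶠ j in atTop, p (n + j)) ↔ ∃ᶠ j in atTop, p j := by
  conv_rhs => rw [← map_add_atTop_eq_nat n, frequently_map]
  simp only [add_comm]

namespace ProbWeightedAutomaton

section Visits

variable {α : Type} {X : Type*} (A : ProbWeightedAutomaton α) (g : A.Q → α → X → A.Q)
  (p : ℚ → Prop) (w : ℕ → α)

/-- The possible successors of the states in `S` under the letter `a`. -/
def post (a : α) (S : Set A.Q) : Set A.Q := {q' | ∃ q ∈ S, 0 < A.trans q a q'}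

/-- The states that are reachable from `S` in `n` steps along the word `w`. -/
def reachFrom (S : Set A.Q) (n : ℕ) : Set A.Q := flow (fun i => A.post (w i)) n S

/-- The states that are reachable at time `n` along the word `w`. -/
abbrev reach (n : ℕ) : Set A.Q := A.reachFrom w {q | 0 < A.init q} n

/-- The path from `q` along the word `w` and the noise `ω` takes weights with property `p`
infinitely often. -/
def Visits (q : A.Q) (ω : ℕ → X) : Prop := ∃ᶠ n in atTop, p (A.weights w (drive g w q ω) n)

variable {A g p w}

lemma weights_suffix (q : A.Q) (ω : ℕ → X) (n j : ℕ) :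
    A.weights (suffix n w) (drive g (suffix n w) (drive g w q ω n) (suffix n ω)) j =
      A.weights w (drive g w q ω) (n + j) := by
  simp only [weights, add_assoc n j 1, drive_add w q ω n]
  rfl

lemma visits_suffix_iff {q : A.Q} {ω : ℕ → X} (n : ℕ) :
    A.Visits g p (suffix n w) (drive g w q ω n) (suffix n ω) ↔ A.Visits g p w q ω := by
  simp only [Visits, weights_suffix]
  exact frequently_add_atTop_iff (p := fun j => p (A.weights w (drive g w q ω) j)) n

lemma suffix_reachFrom (S : Set A.Q) (n : ℕ) :
    suffix n (A.reachFrom w S) = A.reachFrom (suffix n w) (A.reachFrom w S n) :=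
  funext fun _ => flow_add ..

lemma mapsTo_noiseMaps_reachFrom {ω : ℕ → X}
    (hω : ∀ n q, 0 < A.trans q (w n) (g q (w n) (ω n))) (S : Set A.Q) (n : ℕ) :
    Set.MapsTo (noiseMaps g w ω n) (A.reachFrom w S n) (A.reachFrom w S (n + 1)) :=
  fun q hq => ⟨q, hq, hω n q⟩

variable [MeasurableSpace X]

lemma measurable_frequently_weights : Measurable fun r => ∃ᶠ n in atTop, p (A.weights w r n) := by
  simp only [frequently_atTop]
  have hp : Measurable p := .of_discrete
  exact .forall fun N => .exists fun n => .and measurable_const (hp.comp (A.measurable_weights w n))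

lemma measurable_visits (hg : ∀ q a, Measurable (g q a)) (q : A.Q) :
    Measurable (A.Visits g p w q) :=
  measurable_frequently_weights.comp (measurable_drive_right hg w q)

namespace IsRandomMapping

variable {μ : Measure X} [IsProbabilityMeasure μ] (hg : A.IsRandomMapping μ g)
include hg

lemma frequently_runMeasure_iff :
    (∃ᶠ r in ae (A.runMeasure w), ∃ᶠ n in atTop, p (A.weights w r n)) ↔
      ∃ q, 0 < A.init q ∧ ∃ᶠ ω in ae (iid μ), A.Visits g p w q ω := by
  rw [Filter.Frequently, hg.ae_runMeasure_iff w measurable_frequently_weights.not]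
  push Not
  rfl

lemma ae_not_visits_of_trans_pos {q q' : A.Q} (hpos : 0 < A.trans q (w 0) q')
    (h : ∀ᵐ ω ∂iid μ, ¬ A.Visits g p w q ω) :
    ∀ᵐ ω ∂iid μ, ¬ A.Visits g p (suffix 1 w) q' ω := by
  by_contra hvisits
  have hfreq := frequently_prefix_and_suffix (n := 1) (t := fun _ => g q (w 0) ⁻¹' {q'})
    (fun _ => hg.measurable q (w 0) (measurableSet_singleton q'))
    (fun _ _ => (hg.measure_preimage_singleton q (w 0) q').symm ▸ hpos.ne')
    (measurable_visits hg.measurable q') hvisits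
  obtain ⟨ω, ⟨hω, hvis⟩, hnot⟩ := (hfreq.and_eventually h).exists
  have hfirst : drive g w q ω 1 = q' := hω 0 one_pos
  exact hnot ((visits_suffix_iff 1).1 (hfirst.symm ▸ hvis))

variable (hnever : ¬ ∃ᶠ r in ae (A.runMeasure w), ∃ᶠ n in atTop, p (A.weights w r n))

include hnever in
lemma ae_not_visits_of_mem_reach (n : ℕ) {q : A.Q} (hq : q ∈ A.reach w n) :
    ∀ᵐ ω ∂iid μ, ¬ A.Visits g p (suffix n w) q ω := by
  induction n generalizing q with
  | zero =>
    rw [suffix_zero]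
    exact not_frequently.1 fun hfreq => hnever (hg.frequently_runMeasure_iff.2 ⟨q, hq, hfreq⟩)
  | succ n ih =>
    obtain ⟨q', hq', hpos⟩ := hq
    rw [← suffix_suffix]
    exact hg.ae_not_visits_of_trans_pos hpos (ih hq')

include hnever in
lemma ae_forall_not_visits : ∀ᵐ ω ∂iid μ, ∀ n, ∀ q ∈ A.reach w n,
    ¬ A.Visits g p (suffix n w) q (suffix n ω) := by
  refine ae_all_iff.2 fun n => (ae_ball_iff (Set.to_countable _)).2 fun q hq => ?_
  exact (measurePreserving_suffix_iid μ n).quasiMeasurePreserving.ae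
    (hg.ae_not_visits_of_mem_reach hnever n hq)

lemma ae_frequently_visits
    (h : ∃ᶠ r in ae (A.runMeasure w), ∃ᶠ n in atTop, p (A.weights w r n)) :
    ∀ᵐ ω ∂iid μ, ∃ᶠ n in atTop, ∃ q ∈ A.reach w n,
      A.Visits g p (suffix n w) q (suffix n ω) := by
  have hreach (n : ℕ) : Measurable fun ω : ℕ → X =>
      ∃ q ∈ A.reach w n, A.Visits g p (suffix n w) q ω :=
    .exists fun q => .and measurable_const (measurable_visits hg.measurable q)
  refine (ae_or_ae_not_of_tail fun N => ⟨{ω | ∃ᶠ n in atTop, ∃ q ∈ A.reach w (N + n),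
    A.Visits g p (suffix (N + n) w) q (suffix n ω)}, ?_, fun ω => ?_⟩).resolve_right
    fun hnever => ?_
  · simp only [frequently_atTop]
    exact (Measurable.forall fun m => .exists fun n => .and measurable_const
      ((hreach (N + n)).comp (measurable_suffix n))).setOf
  · simp only [Set.mem_ofPred_eq, suffix_suffix]
    exact (frequently_add_atTop_iff N).symm
  · obtain ⟨q, hq, hvisits⟩ := hg.frequently_runMeasure_iff.1 h
    obtain ⟨ω, hω, hnot, hpos⟩ :=
      (hvisits.and_eventually (hnever.and (hg.ae_trans_pos w))).exists
    refine hnot (.of_forall fun n => ⟨_, mapsTo_flow (mapsTo_noiseMaps_reachFrom hpos _) n hq, ?_⟩)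
    exact (visits_suffix_iff n).2 hω

end IsRandomMapping

end Visits

section Dual

variable {α : Type} (A : ProbWeightedAutomaton α)

/-- The second component of a state of the dual automaton: before the guess; or after it, with the
guessed edge `e`, the present states `T` of the paths whose weights must not exceed that of `e`,
and the breakpoint set `B`; or after the weight of `e` has been exceeded. -/
inductive DualPhase
  | wait
  | track (e : A.Edge) (T B : Set A.Q)
  | fail

namespace DualPhase

variable {A}

/-- The encoding that shows that there are finitely many phases. -/
def toOption : A.DualPhase → Option (Option (A.Edge × Set A.Q × Set A.Q))
  | wait => none
  | track e T B => some (some (e, T, B))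
  | fail => some none

lemma toOption_injective : Function.Injective (toOption (A := A)) := by
  rintro (_ | ⟨e, T, B⟩ | _) (_ | ⟨e', T', B'⟩ | _) <;> simp [toOption]

instance instFinite [Finite α] : Finite A.DualPhase := .of_injective _ toOption_injective

instance instMeasurableSpace : MeasurableSpace A.DualPhase := ⊤

instance instDiscreteMeasurableSpace : DiscreteMeasurableSpace A.DualPhase := ⟨fun _ => trivial⟩

instance instNonempty : Nonempty A.DualPhase := ⟨wait⟩

open Classical in
/-- The phase after the letter `a`, where `S` is the new reachable set and `u` moves the states. -/
noncomputable def next (a : α) (S : Set A.Q) (u : A.Q → A.Q) (guess : A.DualPhase) :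
    A.DualPhase → A.DualPhase
  | wait => guess
  | track e T B =>
    if ∀ q ∈ T, A.weight q a (u q) ≤ A.edgeWeight e then
      track e (u '' T) ((if B = ∅ then S else u '' B) \ u '' T)
    else fail
  | fail => fail

open Classical in
/-- At the breakpoints the dual automaton bets on the opposite of the weight of the guessed edge. -/
noncomputable def weight (M : ℚ) : A.DualPhase → ℚ
  | track e _ B => if B = ∅ then -A.edgeWeight e else -M
  | _ => -M

lemma exists_eq_track_of_lt_weight {M c : ℚ} {φ : A.DualPhase} (hM : -M ≤ c)
    (h : c < φ.weight M) : ∃ e T, φ = track e T ∅ ∧ c < -A.edgeWeight e := by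
  obtain _ | ⟨e, T, B⟩ | _ := φ
  · exact absurd h hM.not_gt
  · by_cases hB : B = ∅
    · subst hB
      exact ⟨e, T, rfl, by rwa [weight, if_pos rfl] at h⟩
    · rw [weight, if_neg hB] at h
      exact absurd h hM.not_gt
  · exact absurd h hM.not_gt

end DualPhase

/-- The random input of the dual automaton: moves of all states, and a guessed phase. -/
abbrev DualNoise : Type := (α × A.Q → A.Q) × A.DualPhase

/-- The states of the dual automaton: a set of reachable states, and a phase. -/
abbrev DualState : Type := Set A.Q × A.DualPhase

/-- The law of independent moves and a uniform guess. -/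
noncomputable def dualNoiseLaw : Measure A.DualNoise :=
  A.moveLaw.prod (uniformOn Set.univ)

/-- The moves of the states of `A` in the noise of the dual automaton. -/
def dualMove (q : A.Q) (a : α) (x : A.DualNoise) : A.Q := x.1 (a, q)

/-- The deterministic transition of the dual automaton, given the noise. -/
noncomputable def dualUpdate (s : A.DualState) (a : α) (x : A.DualNoise) : A.DualState :=
  (A.post a s.1, DualPhase.next a (A.post a s.1) (A.dualMove · a x) x.2 s.2)

variable {A} {s : A.DualState} {e : A.Edge} {S T : Set A.Q} {w : ℕ → α}
  {ω : ℕ → A.DualNoise} {n : ℕ}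

lemma drive_dualUpdate_fst : (drive A.dualUpdate w s ω n).1 = A.reachFrom w s.1 n := by
  induction n with
  | zero => rfl
  | succ n ih => exact congrArg (A.post (w n)) ih

lemma drive_dualUpdate_wait (hω : ∀ i < n, (ω i).2 = .wait) :
    drive A.dualUpdate w (S, .wait) ω n = (A.reachFrom w S n, .wait) := by
  induction n with
  | zero => rfl
  | succ n ih =>
    change A.dualUpdate (drive A.dualUpdate w (S, .wait) ω n) (w n) (ω n) = _
    rw [ih fun i hi => hω i (by lia)]
    exact Prod.ext rfl (hω n n.lt_succ_self)

lemma drive_dualUpdate_track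
    (hbound : ∀ i < n, ∀ q ∈ T, A.weights w (drive A.dualMove w q ω) i ≤ A.edgeWeight e) :
    drive A.dualUpdate w (S, .track e T ∅) ω n = (A.reachFrom w S n,
      .track e (flow (noiseMaps A.dualMove w ω) n '' T)
        (backlog (noiseMaps A.dualMove w ω) (A.reachFrom w S) T n)) := by
  induction n with
  | zero => exact Prod.ext rfl (congrArg (DualPhase.track e · ∅) (Set.image_id T).symm)
  | succ n ih =>
    change A.dualUpdate (drive A.dualUpdate w (S, .track e T ∅) ω n) (w n) (ω n) = _
    rw [ih fun i hi => hbound i (by lia)]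
    refine Prod.ext rfl ?_
    simp only [dualUpdate, DualPhase.next]
    rw [if_pos (Set.forall_mem_image.2 (hbound n n.lt_succ_self)), backlog, flow, Set.image_comp]
    rfl

lemma drive_dualUpdate_track_snd_eq_fail
    (h : ¬ ∀ i < n, ∀ q ∈ T, A.weights w (drive A.dualMove w q ω) i ≤ A.edgeWeight e) :
    (drive A.dualUpdate w (S, .track e T ∅) ω n).2 = .fail := by
  induction n with
  | zero => exact absurd (fun i hi => absurd hi i.not_lt_zero) h
  | succ n ih =>
    change (A.dualUpdate (drive A.dualUpdate w (S, .track e T ∅) ω n) (w n) (ω n)).2 = _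
    by_cases hn : ∀ i < n, ∀ q ∈ T, A.weights w (drive A.dualMove w q ω) i ≤ A.edgeWeight e
    · rw [drive_dualUpdate_track hn]
      refine if_neg fun hstep => h fun i hi => ?_
      obtain hi | rfl := Nat.lt_succ_iff_lt_or_eq.1 hi
      · exact hn i hi
      · exact Set.forall_mem_image.1 hstep
    · simp only [dualUpdate, ih hn, DualPhase.next]

variable (A) [Finite α]

instance instProbDualNoiseLaw : IsProbabilityMeasure A.dualNoiseLaw := by
  unfold dualNoiseLaw; infer_instance

lemma dualNoiseLaw_preimage_snd_ne_zero (φ : A.DualPhase) :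
    A.dualNoiseLaw (Prod.snd ⁻¹' {φ}) ≠ 0 := by
  rw [← Set.univ_prod, dualNoiseLaw, Measure.prod_prod, measure_univ, one_mul, Ne,
    uniformOn_eq_zero_iff Set.finite_univ, Set.univ_inter]
  exact Set.singleton_ne_empty φ

/-- The automaton that guesses, at a random time, a set of paths of `A` into which all other paths
merge, and an upper bound for their weights. -/
noncomputable def dual (M : ℚ) : ProbWeightedAutomaton α where
  Q := A.DualState
  finite_Q := inferInstance
  init := PMF.pure ({q | 0 < A.init q}, .wait)
  trans s a := A.dualNoiseLaw.toPMF.map (A.dualUpdate s a)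
  weight s _ _ := s.2.weight M

lemma dual_init_pos_iff {M : ℚ} {s : A.DualState} :
    0 < (A.dual M).init s ↔ s = ({q | 0 < A.init q}, .wait) := by
  rw [pos_iff_ne_zero]
  exact PMF.mem_support_pure_iff ..

lemma isRandomMapping_dualMove : A.IsRandomMapping A.dualNoiseLaw A.dualMove where
  measurable q a := (measurable_pi_apply (a, q)).comp measurable_fst
  map_eq q a := by
    have hfst : A.dualNoiseLaw.map Prod.fst = A.moveLaw := by
      rw [dualNoiseLaw, Measure.map_fst_prod, measure_univ, one_smul]
    rw [← A.isRandomMapping_moveLaw.map_eq q a, ← hfst,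
      Measure.map_map (measurable_pi_apply (a, q)) measurable_fst]
    rfl

lemma isRandomMapping_dualUpdate (M : ℚ) :
    (A.dual M).IsRandomMapping A.dualNoiseLaw A.dualUpdate where
  measurable s a := .of_discrete
  map_eq s a := by
    have h := PMF.toMeasure_map (β := (A.dual M).Q) (A.dualUpdate s a) A.dualNoiseLaw.toPMF
      .of_discrete
    rwa [Measure.toPMF_toMeasure] at h

variable {A} {M : ℚ}

lemma visits_dual_of_bound
    (hbound : ∀ i, ∀ q ∈ T, A.weights w (drive A.dualMove w q ω) i ≤ A.edgeWeight e)
    (hbreak : ∃ᶠ n in atTop,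
      backlog (noiseMaps A.dualMove w ω) (A.reachFrom w S) T n = ∅) :
    (A.dual M).Visits A.dualUpdate (-A.edgeWeight e ≤ ·) w (S, .track e T ∅) ω := by
  refine hbreak.mono fun n hn => ?_
  change _ ≤ (drive A.dualUpdate w (S, .track e T ∅) ω n).2.weight M
  rw [drive_dualUpdate_track fun i _ => hbound i, DualPhase.weight, if_pos hn]

lemma bound_and_frequently_backlog_of_visits_dual
    (h : (A.dual M).Visits A.dualUpdate (-M < ·) w (S, .track e T ∅) ω) :
    (∀ i, ∀ q ∈ T, A.weights w (drive A.dualMove w q ω) i ≤ A.edgeWeight e) ∧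
      ∃ᶠ n in atTop, backlog (noiseMaps A.dualMove w ω) (A.reachFrom w S) T n = ∅ := by
  have hphase : ∃ᶠ n in atTop, -M < (drive A.dualUpdate w (S, .track e T ∅) ω n).2.weight M := h
  have hbound (n : ℕ) (hn : -M < (drive A.dualUpdate w (S, .track e T ∅) ω n).2.weight M) :
      ∀ i < n, ∀ q ∈ T, A.weights w (drive A.dualMove w q ω) i ≤ A.edgeWeight e := by
    by_contra hfail
    rw [drive_dualUpdate_track_snd_eq_fail hfail] at hn
    exact lt_irrefl _ hn
  refine ⟨fun i => ?_, hphase.mono fun n hn => ?_⟩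
  · obtain ⟨n, hin, hn⟩ := frequently_atTop'.1 hphase i
    exact hbound n hn i hin
  · obtain ⟨e', T', heq, -⟩ := DualPhase.exists_eq_track_of_lt_weight le_rfl hn
    rw [drive_dualUpdate_track (hbound n hn)] at heq
    exact (DualPhase.track.inj heq).2.2

end Dual

section Duality

variable {α : Type} [Finite α] {A : ProbWeightedAutomaton α} {M : ℚ} {e : A.Edge} {S T : Set A.Q}
  {w : ℕ → α} {ω : ℕ → A.DualNoise}

lemma not_visits_of_visits_dual
    (hω : ∀ n q, 0 < A.trans q (w n) (A.dualMove q (w n) (ω n)))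
    (h : (A.dual M).Visits A.dualUpdate (-M < ·) w (S, .track e T ∅) ω) {q : A.Q} (hq : q ∈ S) :
    ¬ A.Visits A.dualMove (A.edgeWeight e < ·) w q ω := by
  obtain ⟨hbound, hbreak⟩ := bound_and_frequently_backlog_of_visits_dual h
  have hmerge := eventually_flow_mem_image (mapsTo_noiseMaps_reachFrom hω S) hbreak hq
  refine not_frequently.2 (hmerge.mono fun n hn => not_lt.2 ?_)
  obtain ⟨t, ht, heq⟩ := hn
  have hweights : A.weights w (drive A.dualMove w t ω) n = A.weights w (drive A.dualMove w q ω) n :=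
    congrArg (fun q' => A.weight q' (w n) (noiseMaps A.dualMove w ω n q')) heq
  exact hweights ▸ hbound n t ht

lemma exists_visits_dual_of_isMaximalNoncoalescing
    (hω : ∀ n q, 0 < A.trans q (w n) (A.dualMove q (w n) (ω n)))
    (hT : IsMaximalNoncoalescing (noiseMaps A.dualMove w ω) (A.reachFrom w S) T)
    (h : ∀ q ∈ T, ¬ A.Visits A.dualMove (A.edgeWeight e < ·) w q ω) :
    ∃ n T', (A.dual M).Visits A.dualUpdate (-A.edgeWeight e ≤ ·) (suffix (n + 1) w)
      (A.reachFrom w S (n + 1), .track e T' ∅) (suffix (n + 1) ω) := by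
  have hbound : ∀ᶠ n in atTop, ∀ q ∈ T,
      A.weights w (drive A.dualMove w q ω) n ≤ A.edgeWeight e :=
    (eventually_all_finite T.toFinite).2 fun q hq =>
      (not_frequently.1 (h q hq)).mono fun _ => not_lt.1
  obtain ⟨n, hn⟩ := eventually_atTop.1 hbound
  have hS := mapsTo_noiseMaps_reachFrom hω S
  have hbreak := (hT.image_flow hS (n + 1)).frequently_backlog_eq_empty
    (S := suffix (n + 1) (A.reachFrom w S)) fun k => hS (n + 1 + k)
  rw [suffix_reachFrom] at hbreak
  refine ⟨n, flow (noiseMaps A.dualMove w ω) (n + 1) '' T,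
    visits_dual_of_bound (fun i => Set.forall_mem_image.2 fun q hq => ?_) hbreak⟩
  exact (weights_suffix q ω (n + 1) i).trans_le (hn _ (by lia) q hq)

lemma exists_visits_dual
    (hω : ∀ n q, 0 < A.trans q (w n) (A.dualMove q (w n) (ω n)))
    (h : ∀ n, ∀ q ∈ A.reach w n,
      ¬ A.Visits A.dualMove (A.edgeWeight e < ·) (suffix n w) q (suffix n ω)) :
    ∃ n T, (A.dual M).Visits A.dualUpdate (-A.edgeWeight e ≤ ·) (suffix (n + 1) w)
      (A.reach w (n + 1), .track e T ∅) (suffix (n + 1) ω) := by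
  obtain ⟨n, T, hT⟩ :=
    exists_isMaximalNoncoalescing_suffix (noiseMaps A.dualMove w ω) (A.reach w)
  have hTS := hT.subset
  rw [suffix_reachFrom] at hT
  obtain ⟨m, T', hvisits⟩ := exists_visits_dual_of_isMaximalNoncoalescing (M := M)
    (w := suffix n w) (ω := suffix n ω) (fun k => hω (n + k)) hT fun q hq => h n q (hTS hq)
  refine ⟨n + m, T', ?_⟩
  rw [suffix_suffix, suffix_suffix, ← suffix_reachFrom] at hvisits
  exact hvisits

lemma frequently_visits_dual
    (h : ¬ ∃ᶠ r in ae (A.runMeasure w), ∃ᶠ n in atTop, A.edgeWeight e < A.weights w r n) :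
    ∃ n T, ∃ᶠ ω in ae (iid A.dualNoiseLaw), (A.dual M).Visits A.dualUpdate (-A.edgeWeight e ≤ ·)
      (suffix (n + 1) w) (A.reach w (n + 1), .track e T ∅) ω := by
  have hg := A.isRandomMapping_dualMove
  by_contra! hnone
  have hnone' : ∀ᵐ ω ∂iid A.dualNoiseLaw, ∀ n T, ¬ (A.dual M).Visits A.dualUpdate
      (-A.edgeWeight e ≤ ·) (suffix (n + 1) w) (A.reach w (n + 1), .track e T ∅)
      (suffix (n + 1) ω) :=
    ae_all_iff.2 fun n => ae_all_iff.2 fun T =>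
      (measurePreserving_suffix_iid _ (n + 1)).quasiMeasurePreserving.ae
        (hnone n T)
  obtain ⟨ω, hω, hvisits, hnot⟩ :=
    ((hg.ae_trans_pos w).and ((hg.ae_forall_not_visits h).and hnone')).exists
  obtain ⟨n, T, hvis⟩ := exists_visits_dual (M := M) hω hvisits
  exact hnot n T hvis

lemma frequently_dual_of_not_frequently
    (h : ¬ ∃ᶠ r in ae (A.runMeasure w), ∃ᶠ n in atTop, A.edgeWeight e < A.weights w r n) :
    ∃ᶠ r in ae ((A.dual M).runMeasure w), ∃ᶠ n in atTop,
      -A.edgeWeight e ≤ (A.dual M).weights w r n := by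
  have hg := A.isRandomMapping_dualUpdate M
  obtain ⟨n, T, hfreq⟩ := frequently_visits_dual (M := M) h
  refine hg.frequently_runMeasure_iff.2 ⟨_, A.dual_init_pos_iff.2 rfl, ?_⟩
  refine (frequently_prefix_and_suffix (n := n + 1)
    (t := fun i => Prod.snd ⁻¹' {if i < n then .wait else .track e T ∅})
    (fun i => measurable_snd .of_discrete) (fun i _ => A.dualNoiseLaw_preimage_snd_ne_zero _)
    (measurable_visits hg.measurable _) hfreq).mono fun ω ⟨hprefix, hvisits⟩ => ?_
  have hwait (i : ℕ) (hi : i < n) : (ω i).2 = .wait := by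
    simpa [hi] using hprefix i (by lia)
  have hguess : (ω n).2 = .track e T ∅ := by
    simpa using hprefix n n.lt_succ_self
  refine (visits_suffix_iff (n + 1)).1 ?_
  have hdrive : drive A.dualUpdate w ({q | 0 < A.init q}, .wait) ω (n + 1) =
      (A.reach w (n + 1), .track e T ∅) := by
    change A.dualUpdate (drive A.dualUpdate w _ ω n) (w n) (ω n) = _
    rw [drive_dualUpdate_wait hwait]
    exact Prod.ext rfl hguess
  exact hdrive ▸ hvisits

lemma not_visits_of_visits_dual_wait (hM : A.edgeWeight e ≤ M)
    (hω : ∀ n q, 0 < A.trans q (w n) (A.dualMove q (w n) (ω n)))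
    (h : (A.dual M).Visits A.dualUpdate (-A.edgeWeight e < ·) w ({q | 0 < A.init q}, .wait) ω)
    (n : ℕ) {q : A.Q} (hq : q ∈ A.reach w n) :
    ¬ A.Visits A.dualMove (A.edgeWeight e ≤ ·) (suffix n w) q (suffix n ω) := by
  intro hvisits
  obtain ⟨m, hnm, hm⟩ := frequently_atTop.1 h n
  obtain ⟨k, rfl⟩ := Nat.exists_eq_add_of_le hnm
  obtain ⟨e', T, hphase, he'⟩ :=
    DualPhase.exists_eq_track_of_lt_weight (neg_le_neg hM) hm
  have htrack : drive A.dualUpdate w ({q | 0 < A.init q}, .wait) ω (n + k) =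
      (A.reach w (n + k), .track e' T ∅) :=
    Prod.ext drive_dualUpdate_fst hphase
  have hdual : (A.dual M).Visits A.dualUpdate (-M < ·) (suffix (n + k) w)
      (A.reach w (n + k), .track e' T ∅) (suffix (n + k) ω) :=
    (htrack ▸ (visits_suffix_iff (n + k)).2 h).mono fun _ => (neg_le_neg hM).trans_lt
  have hreach : drive A.dualMove (suffix n w) q (suffix n ω) k ∈ A.reach w (n + k) :=
    mapsTo_flow (f := suffix n (noiseMaps A.dualMove w ω)) (S := suffix n (A.reach w))
      (fun i => mapsTo_noiseMaps_reachFrom hω _ (n + i)) k hq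
  refine not_visits_of_visits_dual (w := suffix (n + k) w) (ω := suffix (n + k) ω)
    (fun i => hω (n + k + i)) hdual hreach ?_
  rw [← suffix_suffix, ← suffix_suffix]
  exact ((visits_suffix_iff k).2 hvisits).mono fun _ => (neg_lt_neg_iff.1 he').trans_le

lemma not_frequently_of_frequently_dual (hM : A.edgeWeight e ≤ M)
    (h : ∃ᶠ r in ae ((A.dual M).runMeasure w), ∃ᶠ n in atTop,
      -A.edgeWeight e < (A.dual M).weights w r n) :
    ¬ ∃ᶠ r in ae (A.runMeasure w), ∃ᶠ n in atTop, A.edgeWeight e ≤ A.weights w r n := by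
  intro hA
  have hg := A.isRandomMapping_dualMove
  obtain ⟨s, hs, hdual⟩ := (A.isRandomMapping_dualUpdate M).frequently_runMeasure_iff.1 h
  obtain rfl := A.dual_init_pos_iff.1 hs
  obtain ⟨ω, hvisD, hvisA, hω⟩ :=
    (hdual.and_eventually ((hg.ae_frequently_visits hA).and (hg.ae_trans_pos w))).exists
  obtain ⟨n, q, hq, hvisq⟩ := hvisA.exists
  exact not_visits_of_visits_dual_wait hM hω hvisD n hq hvisq

lemma dual_positiveLang_limSup (hM : ∀ e, A.edgeWeight e ≤ M) (w : ℕ → α) :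
    (A.dual M).positiveLang LimSup w = -A.positiveLang LimSup w := by
  obtain ⟨e, he⟩ := A.exists_edgeWeight_eq_positiveLang_limSup w
  refine le_antisymm (not_lt.1 fun hlt => ?_) ?_
  · rw [← he, lt_positiveLang_limSup_iff] at hlt
    have hA := A.le_positiveLang_limSup_iff.1 he.le
    simp only [← Rat.cast_neg, Rat.cast_lt] at hlt
    simp only [Rat.cast_le] at hA
    exact not_frequently_of_frequently_dual (hM e) hlt hA
  · have hA := A.lt_positiveLang_limSup_iff.not.1 he.not_lt
    simp only [Rat.cast_lt] at hA
    rw [← he, le_positiveLang_limSup_iff]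
    simp only [← Rat.cast_neg, Rat.cast_le]
    exact frequently_dual_of_not_frequently hA

end Duality

end ProbWeightedAutomaton

section Topology

lemma isGδ_setOf_eq_zero_of_upperSemicontinuous {X : Type*} [TopologicalSpace X] {f : X → ℝ≥0∞}
    (hf : UpperSemicontinuous f) : IsGδ {x | f x = 0} := by
  have hinter : {x | f x = 0} = ⋂ n : ℕ, f ⁻¹' Set.Iio (n : ℝ≥0∞)⁻¹ := by
    ext x
    simp only [Set.mem_ofPred_eq, Set.mem_iInter, Set.mem_preimage, Set.mem_Iio]
    refine ⟨fun hx n => by simp [hx], fun hx => ?_⟩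
    by_contra hne
    obtain ⟨n, hn⟩ := ENNReal.exists_inv_nat_lt hne
    exact hn.not_gt (hx n)
  exact hinter ▸ .iInter_of_isOpen fun n => hf.isOpen_preimage _

variable {ι α β : Type*} [TopologicalSpace α] [TopologicalSpace β]

lemma continuous_of_dependsOn [DiscreteTopology α] {s : Set ι} [Finite s] {f : (ι → α) → β}
    (hf : DependsOn f s) : Continuous f := by
  refine continuous_iff_continuousAt.2 fun w => ?_
  have : Nonempty β := ⟨f w⟩
  obtain ⟨h, rfl⟩ := dependsOn_iff_exists_comp.1 hf
  exact (continuous_of_discreteTopology.comp (Pi.continuous_domRestrict s)).continuousAt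

lemma dense_setOf_eventually_eq (c : α) : Dense {w : ℕ → α | ∀ᶠ n in atTop, w n = c} := by
  intro w
  refine mem_closure_of_tendsto (f := fun (m n : ℕ) => if n < m then w n else c)
    (tendsto_pi_nhds.2 fun n => ?_) (.of_forall fun m => ?_) (b := atTop)
  · exact tendsto_const_nhds.congr' ((eventually_gt_atTop n).mono fun m hm => (if_pos hm).symm)
  · exact (eventually_ge_atTop m).mono fun n hn => if_neg hn.not_gt

lemma isGδ_setOf_frequently_ne [T1Space α] (c : α) :
    IsGδ {w : ℕ → α | ∃ᶠ n in atTop, w n ≠ c} := by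
  simp only [frequently_atTop, Set.ofPred_forall]
  refine .iInter_of_isOpen fun N => ?_
  simp only [Set.ofPred_exists, Set.ofPred_and]
  exact isOpen_iUnion fun n => isOpen_const.inter (isOpen_ne.preimage (continuous_apply n))

lemma not_isGδ_setOf_eventually_eq [T1Space α] [Nontrivial α] [BaireSpace (ℕ → α)] (c : α) :
    ¬ IsGδ {w : ℕ → α | ∀ᶠ n in atTop, w n = c} := by
  intro h
  obtain ⟨c', hc'⟩ := exists_ne c
  have hdense : Dense {w : ℕ → α | ∃ᶠ n in atTop, w n ≠ c} :=
    (dense_setOf_eventually_eq c').mono fun w hw =>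
      (hw.mono fun n hn => hn.trans_ne hc').frequently
  obtain ⟨w, hw, hw'⟩ :=
    ((dense_setOf_eventually_eq c).inter_of_Gδ h (isGδ_setOf_frequently_ne c) hdense).nonempty
  exact hw' (hw.mono fun n => not_not.2)

end Topology

lemma dependsOn_drive {Q α X : Type*} (g : Q → α → X → Q) (q : Q) (ω : ℕ → X) (n : ℕ) :
    DependsOn (fun w => drive g w q ω n) (Set.Iio n) := by
  intro w w' h
  induction n with
  | zero => rfl
  | succ n ih =>
    have hn : w n = w' n := h n n.lt_succ_self
    change g (drive g w q ω n) (w n) (ω n) = g (drive g w' q ω n) (w' n) (ω n)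
    exact congrArg₂ (g · · (ω n)) (ih fun i hi => h i (Nat.lt_succ_of_lt hi)) hn

namespace ProbWeightedAutomaton

section LimInfTopology

variable {α : Type} (A : ProbWeightedAutomaton α)

lemma dependsOn_weights_drive {X : Type*} (g : A.Q → α → X → A.Q) (q : A.Q) (ω : ℕ → X) (n : ℕ) :
    DependsOn (fun w => A.weights w (drive g w q ω) n) (Set.Iic n) := by
  intro w w' h
  have hn : w n = w' n := h n Set.self_mem_Iic
  simp only [weights, hn, dependsOn_drive g q ω n fun i hi => h i (Set.Iio_subset_Iic_self hi),
    dependsOn_drive g q ω (n + 1) fun i hi => h i (Nat.le_of_lt_succ hi)]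

variable (p : ℕ → ℚ → Prop)

lemma measurableSet_forall_lt_weights (w : ℕ → α) (k : ℕ) :
    MeasurableSet {r | ∀ n < k, p n (A.weights w r n)} := by
  have hp (n : ℕ) : Measurable (p n) := .of_discrete
  exact (Measurable.forall fun n => .imp measurable_const
    ((hp n).comp (A.measurable_weights w n))).setOf

lemma dependsOn_runMeasure_forall_lt (k : ℕ) :
    DependsOn (fun w => A.runMeasure w {r | ∀ n < k, p n (A.weights w r n)}) (Set.Iio k) := by
  intro w w' h
  have hg := A.isRandomMapping_moveLaw
  simp only [hg.runMeasure_eq_map, Measure.map_apply (measurable_drive hg.measurable _)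
    (A.measurableSet_forall_lt_weights p _ k)]
  congr 1
  ext ⟨q, ω⟩
  refine forall₂_congr fun n hn => ?_
  exact iff_of_eq (congrArg (p n)
    (A.dependsOn_weights_drive _ q ω n fun i hi => h i (hi.trans_lt hn)))

lemma runMeasure_forall_eq_iInf (w : ℕ → α) :
    A.runMeasure w {r | ∀ n, p n (A.weights w r n)} =
      ⨅ k, A.runMeasure w {r | ∀ n < k, p n (A.weights w r n)} := by
  have hanti : Antitone fun k => {r | ∀ n < k, p n (A.weights w r n)} :=
    fun k l hkl r hr n hn => hr n (hn.trans_le hkl)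
  rw [← hanti.measure_iInter
    (fun k => (A.measurableSet_forall_lt_weights p w k).nullMeasurableSet) ⟨0, measure_ne_top _ _⟩]
  congr 1
  ext r
  exact ⟨fun h => Set.mem_iInter.2 fun k n _ => h n,
    fun h n => Set.mem_iInter.1 h (n + 1) n n.lt_succ_self⟩

variable [TopologicalSpace α] [DiscreteTopology α]

lemma upperSemicontinuous_runMeasure_forall :
    UpperSemicontinuous fun w => A.runMeasure w {r | ∀ n, p n (A.weights w r n)} := by
  simp only [A.runMeasure_forall_eq_iInf]
  exact upperSemicontinuous_iInf fun k =>
    (continuous_of_dependsOn (A.dependsOn_runMeasure_forall_lt p k)).upperSemicontinuous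

lemma isGδ_positiveLang_limInf_le [Finite α] (θ : ℝ) :
    IsGδ {w | A.positiveLang LimInf w ≤ θ} := by
  have hinter : {w | A.positiveLang LimInf w ≤ θ} =
      ⋂ N, {w | A.runMeasure w {r | ∀ n, N ≤ n → θ < A.weights w r n} = 0} := by
    ext w
    simp only [Set.mem_ofPred_eq, ← not_lt, lt_positiveLang_limInf_iff, frequently_ae_iff, not_not,
      eventually_atTop, Set.mem_iInter, Set.ofPred_exists, measure_iUnion_null_iff]
  exact hinter ▸ .iInter fun N => isGδ_setOf_eq_zero_of_upperSemicontinuous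
    (A.upperSemicontinuous_runMeasure_forall fun n x => N ≤ n → θ < x)

end LimInfTopology

/-- The one-state automaton with weight `1` on the letter `true` and `0` on `false`. -/
noncomputable def detectTrue : ProbWeightedAutomaton Bool where
  Q := Unit
  finite_Q := inferInstance
  init := PMF.pure ()
  trans _ _ := PMF.pure ()
  weight _ a _ := if a then 1 else 0

lemma almostSureLang_limSup_detectTrue (w : ℕ → Bool) :
    detectTrue.almostSureLang LimSup w = LimSup fun n => if w n then 1 else 0 := by
  have hweights (r : ℕ → detectTrue.Q) :
      detectTrue.weights w r = fun n => if w n then 1 else 0 := rfl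
  rw [almostSureLang_eq_liminf _ (detectTrue.measurable_limSup_weights w)]
  simp only [hweights, liminf_const]

lemma almostSureLang_limSup_detectTrue_pos_iff (w : ℕ → Bool) :
    0 < detectTrue.almostSureLang LimSup w ↔ ∃ᶠ n in atTop, w n = true := by
  have hrange : (Set.range fun n => ((if w n then 1 else 0 : ℚ) : ℝ)).Finite :=
    detectTrue.finite_range_weights w fun _ => ()
  rw [almostSureLang_limSup_detectTrue, LimSup, lt_limsup_iff_of_finite_range hrange]
  refine frequently_congr (.of_forall fun n => ?_)
  cases w n <;> simp

end ProbWeightedAutomaton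

/-- Changing the signs of the weights turns the `C`-language of an automaton into the opposite of
its `D`-language. -/
def NegDual (C D : AutomataClass) : Prop :=
  ∀ (α : Type) [Finite α] (A : ProbWeightedAutomaton α) (w : ℕ → α), D α A w = -C α A.neg w

lemma Reducible.of_negDual {C C' D D' : AutomataClass} (h : Reducible C C') (hD : NegDual C D)
    (hD' : NegDual C' D') : Reducible D D' := by
  intro α _ A
  obtain ⟨A', hA'⟩ := h α A.neg
  refine ⟨A'.neg, fun w => ?_⟩
  rw [hD, hD', A'.neg_neg, hA']

lemma NegDual.symm {C D : AutomataClass} (h : NegDual C D) : NegDual D C := fun α _ A w => by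
  rw [h, A.neg_neg, neg_neg]

lemma negDual_posLimSup_asLimInf : NegDual PosLimSup AsLimInf :=
  fun _ _ A w => A.almostSureLang_limInf_eq_neg w

lemma negDual_posLimInf_asLimSup : NegDual PosLimInf AsLimSup :=
  fun _ _ A w => A.almostSureLang_limSup_eq_neg w

lemma reducible_posLimSup_asLimInf : Reducible PosLimSup AsLimInf := by
  intro α _ A
  obtain ⟨M, hM⟩ := (Set.finite_range A.edgeWeight).bddAbove
  refine ⟨(A.dual M).neg, fun w => ?_⟩
  rw [negDual_posLimSup_asLimInf, (A.dual M).neg_neg]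
  exact (neg_eq_iff_eq_neg.2 <|
    ProbWeightedAutomaton.dual_positiveLang_limSup (Set.forall_mem_range.1 hM) w).symm

lemma not_reducible_asLimSup_posLimInf : ¬ Reducible AsLimSup PosLimInf := by
  intro h
  obtain ⟨A, hA⟩ := h Bool ProbWeightedAutomaton.detectTrue
  have hset : {w : ℕ → Bool | ∀ᶠ n in atTop, w n = false} = {w | A.positiveLang LimInf w ≤ 0} := by
    ext w
    have hw : ProbWeightedAutomaton.detectTrue.almostSureLang LimSup w =
        A.positiveLang LimInf w := hA w
    rw [Set.mem_ofPred_eq, Set.mem_ofPred_eq, ← hw, ← not_lt,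
      ProbWeightedAutomaton.almostSureLang_limSup_detectTrue_pos_iff, not_frequently]
    simp only [Bool.not_eq_true]
  exact not_isGδ_setOf_eventually_eq false (hset ▸ A.isGδ_positiveLang_limInf_le 0)

theorem mainTheorem5 :
    (Reducible AsLimInf PosLimSup ∧ Reducible PosLimSup AsLimInf) ∧
      Incomparable AsLimSup PosLimInf := by
  have hLimSup := negDual_posLimSup_asLimInf
  have hLimInf := negDual_posLimInf_asLimSup
  exact ⟨⟨reducible_posLimSup_asLimInf.of_negDual hLimSup hLimSup.symm,
    reducible_posLimSup_asLimInf⟩, not_reducible_asLimSup_posLimInf,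
    fun h => not_reducible_asLimSup_posLimInf (h.of_negDual hLimInf hLimInf.symm)⟩
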